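/- Let $P$ be a symmetric polytope in $\mathbb R^n$, i.e. the convex hull of finitely many points with $P=-P$ and non-empty interior. Then there exists $p_0=p_0(P)$ such that for every real $p\ge p_0$ there exists a symmetric convex body (compact convex set with non-empty interior) $K_p\supseteq P$ such that $$ d_s(P,K_p)\;\le\; 2n^2\,|P|\,\frac{\log p}{p}, $$ where $|\cdot|$ is volume and $d_s(C,K)=|(C\setminus K)\cup(K\setminus C)|$, and $K_p$ is $p$-uniformly convex with constant $C_p=\frac{1}{p\,2^p}$: one has $p\ge 2$ and, with $\|\cdot\|_{K_p}$ the norm with unit ball $K_p$, $$ \Big\|\frac{x+y}{2}\Big\|_{K_p}\le 1-C_p\,\|x-y\|_{K_p}^{\,p}\qquad\text{for all } x,y\in\partial K_p. $$ Moreover one can take $K_p=|P^\circ|^{-1/n}\,\big(Z_p(P_1)\big)^\circ$ with $P_1=|P^\circ|^{-1/n}P^\circ$. Here $C^\circ=\{y:\langle x,y\rangle\le 1\text{ for all }x\in C\}$ is the polar of $C$, and $Z_p(K)$ is the $L_p$-centroid body of $K$, the convex body with support function $h_{Z_p(K)}(\theta)=\max_{y\in Z_p(K)}\langle\theta,y\rangle=\big(\int_K|\langle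 x,\theta\rangle|^p\,dx\big)^{1/p}$ for unit vectors $\theta$. -/

import Mathlib

open MeasureTheory
open scoped Pointwise

/-- A symmetric convex body in `ℝⁿ`: a compact convex set with non-empty interior such that
`x ∈ K` implies `-x ∈ K`. -/
structure IsSymmetricConvexBody {n : ℕ} (K : Set (EuclideanSpace ℝ (Fin n))) : Prop where
  convex : Convex ℝ K
  isCompact : IsCompact K
  interior_nonempty : (interior K).Nonempty
  neg_mem : ∀ x ∈ K, -x ∈ K

/-- A symmetric polytope in `ℝⁿ`: the convex hull of finitely many points, with non-empty interior,
such that `x ∈ P` implies `-x ∈ P`. -/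
structure IsSymmetricPolytope {n : ℕ} (P : Set (EuclideanSpace ℝ (Fin n))) : Prop where
  exists_finset : ∃ s : Finset (EuclideanSpace ℝ (Fin n)),
    P = convexHull ℝ (s : Set (EuclideanSpace ℝ (Fin n)))
  interior_nonempty : (interior P).Nonempty
  neg_mem : ∀ x ∈ P, -x ∈ P

/-- The polar body `C° = {y : ⟨x, y⟩ ≤ 1 for all x ∈ C}`. -/
def polarBody {n : ℕ} (C : Set (EuclideanSpace ℝ (Fin n))) : Set (EuclideanSpace ℝ (Fin n)) :=
  {y | ∀ x ∈ C, inner ℝ x y ≤ 1}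

/-- The support function `h_C(x) = max {⟨x, y⟩ : y ∈ C}` (for non-empty compact `C` the supremum is
a maximum). -/
noncomputable def supportFunction {n : ℕ} (C : Set (EuclideanSpace ℝ (Fin n)))
    (x : EuclideanSpace ℝ (Fin n)) : ℝ :=
  sSup ((fun y => inner ℝ x y) '' C)

/-- `Z` is the `L_p`-centroid body of `K`: the (unique) convex body whose support function on the
unit sphere is `θ ↦ (∫_K |⟨x, θ⟩|^p dx)^{1/p}`. -/
structure IsLpCentroidBody {n : ℕ} (p : ℝ) (K Z : Set (EuclideanSpace ℝ (Fin n))) : Prop where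
  convex : Convex ℝ Z
  isCompact : IsCompact Z
  interior_nonempty : (interior Z).Nonempty
  supportFunction_eq : ∀ θ : EuclideanSpace ℝ (Fin n), ‖θ‖ = 1 →
    supportFunction Z θ = (∫ x in K, |inner ℝ x θ| ^ p) ^ (1 / p)

/-- `K` is a `p`-uniformly convex body with constant `C > 0`, where `2 ≤ p < ∞`: it is a symmetric
convex body and `‖(x + y) / 2‖_K ≤ 1 - C ‖x - y‖_K ^ p` for all boundary points `x, y`. The norm
`‖·‖_K` with unit ball `K` is the Minkowski functional `gauge K`. -/
structure IsUniformlyConvexBody {n : ℕ} (p C : ℝ) (K : Set (EuclideanSpace ℝ (Fin n))) : Prop where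
  isSymmetricConvexBody : IsSymmetricConvexBody K
  two_le : 2 ≤ p
  const_pos : 0 < C
  gauge_midpoint_le : ∀ x ∈ frontier K, ∀ y ∈ frontier K,
    gauge K ((1 / 2 : ℝ) • (x + y)) ≤ 1 - C * gauge K (x - y) ^ p

/-- The symmetric difference metric `d_s(C, K) = |(C \ K) ∪ (K \ C)|`. -/
noncomputable def symmDiffDist {n : ℕ} (C K : Set (EuclideanSpace ℝ (Fin n))) : ℝ :=
  volume.real ((C \ K) ∪ (K \ C))

/-!
Write `Q` for the polar of `P`. Since `|·|^{-1/n}` rescales `Q` to volume one, the norm of `K_p` at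
`x` is the `L_p` norm of the linear form `⟨·, x⟩` with respect to the uniform probability measure
on `Q`. The assertions are therefore statements about `L_p` norms.

* **Uniform convexity.** Clarkson's inequality for `p ≥ 2`
  (`centroidSeminorm_clarkson`) gives, for unit vectors,
  `‖(x + y) / 2‖ ≤ (1 - 2⁻ᵖ ‖x - y‖ᵖ)^{1/p}`, and Bernoulli's inequality removes the root
  (`Seminorm.midpoint_le_of_clarkson`).
* **Inclusion.** For `x ∈ P` the form `⟨·, x⟩` is bounded by one on `Q`, hence so is its `L_p` norm.
* **Volume.** The form `⟨·, x⟩` is close to its maximum over `Q` on a copy of `Q` shrunk by the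
  factor `1 / p` towards a maximizer. Hence its `L_p` norm is at least `1 / r` times the maximum,
  where `r = p^{n/p} / (1 - 2/p)` (`le_mul_centroidSeminorm`). By the bipolar theorem
  `K_p ⊆ r P`, so the volume difference is at most `(rⁿ - 1) |P|`, and
  `rⁿ = 1 + (n² + o(1)) log p / p` (`exists_forall_dilation_pow_le`). The factor `2` in the
  statement absorbs the error term. This argument applies to every symmetric convex body.

The body `Z_p` is produced from its support function as `Seminorm.dualBody`. That the
support function is the prescribed one is the Hahn-Banach theorem
(`Seminorm.exists_inner_le_and_eq`), which also identifies the polar of `Z_p` with the unit ball.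
-/

/-! ### Symmetric convex bodies and their polars -/

lemma zero_mem_interior_of_symmetric {E : Type*} [AddCommGroup E] [Module ℝ E] [TopologicalSpace E]
    [IsTopologicalAddGroup E] [ContinuousSMul ℝ E] {K : Set E} (hc : Convex ℝ K)
    (hi : (interior K).Nonempty) (hs : ∀ x ∈ K, -x ∈ K) : (0 : E) ∈ interior K := by
  obtain ⟨x, hx⟩ := hi
  have hK : -K = K := by
    ext y
    exact ⟨fun h => by simpa using hs _ (Set.mem_neg.1 h), fun h => hs y h⟩
  have hx' : -x ∈ interior K := by
    have h : -x ∈ interior (-K) := by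
      have h2 := (Homeomorph.neg E).preimage_interior K
      have h3 : -x ∈ (Homeomorph.neg E) ⁻¹' interior K := by simpa using hx
      rw [h2] at h3
      exact h3
    rwa [hK] at h
  simpa using hc.interior hx hx' (show (0 : ℝ) ≤ 1 / 2 by norm_num)
    (show (0 : ℝ) ≤ 1 / 2 by norm_num) (by norm_num)

namespace IsSymmetricConvexBody

variable {n : ℕ} {K : Set (EuclideanSpace ℝ (Fin n))}

lemma zero_mem_interior (h : IsSymmetricConvexBody K) : 0 ∈ interior K :=
  zero_mem_interior_of_symmetric h.convex h.interior_nonempty h.neg_mem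

lemma zero_mem (h : IsSymmetricConvexBody K) : 0 ∈ K := interior_subset h.zero_mem_interior

lemma volume_real_pos (h : IsSymmetricConvexBody K) : 0 < volume.real K :=
  ENNReal.toReal_pos (Measure.measure_pos_of_nonempty_interior _ h.interior_nonempty).ne'
    h.isCompact.measure_lt_top.ne

lemma smul (h : IsSymmetricConvexBody K) {a : ℝ} (ha : a ≠ 0) :
    IsSymmetricConvexBody (a • K) where
  convex := h.convex.smul a
  isCompact := h.isCompact.smul a
  interior_nonempty := by
    rw [interior_smul₀ ha]
    exact h.interior_nonempty.smul_set
  neg_mem := by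
    rintro _ ⟨x, hx, rfl⟩
    exact ⟨-x, h.neg_mem x hx, by simp⟩

end IsSymmetricConvexBody

lemma IsSymmetricPolytope.isSymmetricConvexBody {n : ℕ} {P : Set (EuclideanSpace ℝ (Fin n))}
    (h : IsSymmetricPolytope P) : IsSymmetricConvexBody P where
  convex := by
    obtain ⟨s, rfl⟩ := h.exists_finset
    exact convex_convexHull ℝ _
  isCompact := by
    obtain ⟨s, rfl⟩ := h.exists_finset
    exact s.finite_toSet.isCompact_convexHull ℝ
  interior_nonempty := h.interior_nonempty
  neg_mem := h.neg_mem

/-- The polar of a symmetric convex body is a symmetric convex body: a ball inside the body bounds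
the polar, and a ball around the body yields a ball inside the polar. -/
lemma IsSymmetricConvexBody.polarBody {n : ℕ} {K : Set (EuclideanSpace ℝ (Fin n))}
    (h : IsSymmetricConvexBody K) : IsSymmetricConvexBody (polarBody K) where
  convex := by
    intro y hy z hz a b ha hb hab x hx
    rw [inner_add_right, inner_smul_right, inner_smul_right]
    calc a * inner ℝ x y + b * inner ℝ x z ≤ a * 1 + b * 1 := by
          gcongr
          exacts [hy x hx, hz x hx]
      _ = 1 := by linarith
  isCompact := by
    have hclosed : IsClosed (_root_.polarBody K) := by
      have : _root_.polarBody K = ⋂ x ∈ K, {y | inner ℝ x y ≤ 1} := by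
        ext y
        simp [_root_.polarBody]
      rw [this]
      exact isClosed_biInter fun x _ => isClosed_le (by fun_prop) continuous_const
    refine Metric.isCompact_of_isClosed_isBounded hclosed ?_
    obtain ⟨r, hr, hball⟩ := Metric.nhds_basis_closedBall.mem_iff.1
      (mem_interior_iff_mem_nhds.1 h.zero_mem_interior)
    refine (Metric.isBounded_iff_subset_closedBall 0).2 ⟨1 / r, fun y hy => ?_⟩
    rw [mem_closedBall_zero_iff, le_div_iff₀ hr]
    rcases eq_or_ne y 0 with rfl | hy0
    · simp
    have hy0' : 0 < ‖y‖ := norm_pos_iff.2 hy0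
    have h1 := hy ((r / ‖y‖) • y) (hball (by
      rw [mem_closedBall_zero_iff, norm_smul, Real.norm_of_nonneg (by positivity)]
      field_simp
      exact le_rfl))
    rw [real_inner_smul_left, real_inner_self_eq_norm_sq] at h1
    calc ‖y‖ * r = r / ‖y‖ * ‖y‖ ^ 2 := by field_simp
      _ ≤ 1 := h1
  interior_nonempty := by
    obtain ⟨R, hR⟩ := (Metric.isBounded_iff_subset_closedBall 0).1 h.isCompact.isBounded
    have hR0 : 0 < |R| + 1 := by positivity
    refine ⟨0, mem_interior_iff_mem_nhds.2 (Metric.nhds_basis_closedBall.mem_iff.2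
      ⟨1 / (|R| + 1), by positivity, fun y hy x hx => ?_⟩)⟩
    rw [mem_closedBall_zero_iff] at hy
    have hx := mem_closedBall_zero_iff.1 (hR hx)
    calc inner ℝ x y ≤ ‖x‖ * ‖y‖ := real_inner_le_norm x y
      _ ≤ (|R| + 1) * (1 / (|R| + 1)) := by
          gcongr
          linarith [le_abs_self R]
      _ = 1 := by field_simp
  neg_mem := by
    intro y hy x hx
    have := hy (-x) (h.neg_mem x hx)
    rwa [inner_neg_left, ← inner_neg_right] at this

/-- The nontrivial inclusion of the bipolar theorem. -/
lemma mem_of_forall_polarBody {n : ℕ} {C : Set (EuclideanSpace ℝ (Fin n))} (hc : Convex ℝ C)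
    (hcl : IsClosed C) (h0 : 0 ∈ C) {x : EuclideanSpace ℝ (Fin n)}
    (hx : ∀ y ∈ polarBody C, inner ℝ x y ≤ 1) : x ∈ C := by
  by_contra hxC
  obtain ⟨f, u, hfu, hux⟩ := geometric_hahn_banach_closed_point hc hcl hxC
  have hu : 0 < u := by simpa using hfu 0 h0
  set w := (InnerProductSpace.toDual ℝ _).symm f with hw
  have hf : ∀ z, f z = inner ℝ z w := fun z => by
    rw [hw, real_inner_comm, InnerProductSpace.toDual_symm_apply]
  have h1 := hx (u⁻¹ • w) fun z hz => by
    rw [inner_smul_right, ← hf, inv_mul_le_one₀ hu]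
    exact (hfu z hz).le
  rw [inner_smul_right, ← hf, inv_mul_le_one₀ hu] at h1
  exact absurd hux (not_lt.2 h1)

/-! ### Convex bodies with a given support function -/

/-- By the Hahn-Banach theorem, a seminorm is at each point the maximum of the linear forms below
it. -/
lemma Seminorm.exists_inner_le_and_eq {E : Type*} [NormedAddCommGroup E] [InnerProductSpace ℝ E]
    [FiniteDimensional ℝ E] (q : Seminorm ℝ E) (θ : E) :
    ∃ z : E, (∀ x, inner ℝ x z ≤ q x) ∧ inner ℝ θ z = q θ := by
  obtain rfl | hθ := eq_or_ne θ 0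
  · exact ⟨0, fun x => by simp, by simp⟩
  let f : E →ₗ.[ℝ] ℝ := LinearPMap.mkSpanSingleton θ (q θ) hθ
  obtain ⟨g, hgf, hgq⟩ := exists_extension_of_le_sublinear f q
    (fun c hc x => by rw [map_smul_eq_mul, Real.norm_of_nonneg hc.le]) (map_add_le_add q) (by
      rintro ⟨x, hx⟩
      obtain ⟨c, rfl⟩ := Submodule.mem_span_singleton.1 hx
      rw [show f ⟨c • θ, hx⟩ = c • q θ from LinearPMap.mkSpanSingleton'_apply .., smul_eq_mul]
      simp only [map_smul_eq_mul]
      gcongr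
      exact le_abs_self c)
  have key : ∀ x, inner ℝ x ((InnerProductSpace.toDual ℝ E).symm
      (LinearMap.toContinuousLinearMap g)) = g x := fun x => by
    rw [real_inner_comm, InnerProductSpace.toDual_symm_apply]
    rfl
  refine ⟨_, fun x => (key x).le.trans (hgq x), (key θ).trans ?_⟩
  exact (hgf ⟨θ, Submodule.mem_span_singleton_self θ⟩).trans
    (LinearPMap.mkSpanSingleton_apply ℝ ℝ hθ (q θ))

lemma Seminorm.gauge_closedBall {E : Type*} [AddCommGroup E] [Module ℝ E] (q : Seminorm ℝ E) :
    gauge (q.closedBall 0 1) = q := by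
  ext x
  apply le_antisymm
  · calc gauge (q.closedBall 0 1) x ≤ gauge (q.ball 0 1) x :=
          gauge_mono (q.absorbent_ball_zero one_pos) (q.ball_subset_closedBall 0 1) x
      _ = q x := by rw [q.gauge_ball]
  · refine le_csInf (q.absorbent_closedBall_zero one_pos).gauge_set_nonempty ?_
    rintro r ⟨hr, y, hy, rfl⟩
    rw [q.mem_closedBall_zero] at hy
    change q (r • y) ≤ r
    rw [map_smul_eq_mul, Real.norm_of_nonneg hr.le]
    exact mul_le_of_le_one_right hr.le hy

/-- The convex body with support function `q`: the vectors whose inner product with every `x` is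
at most `q x`. -/
def Seminorm.dualBody {n : ℕ} (q : Seminorm ℝ (EuclideanSpace ℝ (Fin n))) :
    Set (EuclideanSpace ℝ (Fin n)) :=
  {z | ∀ x, inner ℝ x z ≤ q x}

namespace Seminorm

variable {n : ℕ} (q : Seminorm ℝ (EuclideanSpace ℝ (Fin n)))

lemma supportFunction_dualBody (θ : EuclideanSpace ℝ (Fin n)) :
    supportFunction q.dualBody θ = q θ := by
  obtain ⟨z, hz, hzθ⟩ := q.exists_inner_le_and_eq θ
  refine IsGreatest.csSup_eq ⟨⟨z, hz, hzθ⟩, ?_⟩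
  rintro _ ⟨w, hw, rfl⟩
  exact hw θ

lemma polarBody_dualBody : polarBody q.dualBody = q.closedBall 0 1 := by
  ext x
  rw [q.mem_closedBall_zero]
  constructor
  · intro hx
    obtain ⟨z, hz, hzx⟩ := q.exists_inner_le_and_eq x
    rw [← hzx, real_inner_comm]
    exact hx z hz
  · intro hx z hz
    rw [real_inner_comm]
    exact (hz x).trans hx

/-- A seminorm equivalent to the Euclidean norm is the support function of a symmetric convex
body. -/
lemma isSymmetricConvexBody_dualBody {c C : ℝ} (hc : 0 < c) (hlow : ∀ x, c * ‖x‖ ≤ q x)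
    (hup : ∀ x, q x ≤ C * ‖x‖) : IsSymmetricConvexBody q.dualBody where
  convex := by
    intro y hy z hz a b ha hb hab x
    rw [inner_add_right, inner_smul_right, inner_smul_right]
    calc a * inner ℝ x y + b * inner ℝ x z ≤ a * q x + b * q x := by
          gcongr
          exacts [hy x, hz x]
      _ = q x := by rw [← add_mul, hab, one_mul]
  isCompact := by
    have hclosed : IsClosed q.dualBody := by
      have : q.dualBody = ⋂ x, {y | inner ℝ x y ≤ q x} := by
        ext y
        simp [dualBody]
      rw [this]
      exact isClosed_iInter fun x => isClosed_le (by fun_prop) continuous_const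
    refine Metric.isCompact_of_isClosed_isBounded hclosed ?_
    refine (Metric.isBounded_iff_subset_closedBall 0).2 ⟨|C|, fun y hy => ?_⟩
    rw [mem_closedBall_zero_iff]
    rcases eq_or_ne y 0 with rfl | hy0
    · simp
    have h1 := (hy y).trans (hup y)
    rw [real_inner_self_eq_norm_sq, sq] at h1
    exact (le_of_mul_le_mul_right h1 (norm_pos_iff.2 hy0)).trans (le_abs_self C)
  interior_nonempty := by
    refine ⟨0, mem_interior_iff_mem_nhds.2 (Metric.nhds_basis_closedBall.mem_iff.2
      ⟨c, hc, fun y hy x => ?_⟩)⟩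
    rw [mem_closedBall_zero_iff] at hy
    calc inner ℝ x y ≤ ‖x‖ * ‖y‖ := real_inner_le_norm x y
      _ ≤ ‖x‖ * c := by gcongr
      _ ≤ q x := by rw [mul_comm]; exact hlow x
  neg_mem := by
    intro y hy x
    have := hy (-x)
    rwa [inner_neg_left, ← inner_neg_right, map_neg_eq_map] at this

end Seminorm

/-! ### Clarkson's inequality and the centroid seminorm -/

/-- The scalar case of Clarkson's inequality. -/
lemma abs_add_div_two_rpow_add_abs_sub_div_two_rpow_le {p : ℝ} (hp : 2 ≤ p) (a b : ℝ) :
    |(a + b) / 2| ^ p + |(a - b) / 2| ^ p ≤ (|a| ^ p + |b| ^ p) / 2 := by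
  have hsq : ∀ s : ℝ, |s| ^ p = (s ^ 2) ^ (p / 2) := fun s => by
    rw [← sq_abs, ← Real.rpow_natCast, ← Real.rpow_mul (abs_nonneg s)]
    congr 1
    push_cast
    ring
  have hp2 : 1 ≤ p / 2 := by linarith
  simp only [hsq]
  calc (((a + b) / 2) ^ 2) ^ (p / 2) + (((a - b) / 2) ^ 2) ^ (p / 2)
      ≤ (((a + b) / 2) ^ 2 + ((a - b) / 2) ^ 2) ^ (p / 2) :=
        Real.add_rpow_le_rpow_add (sq_nonneg _) (sq_nonneg _) hp2
    _ = ((1 / 2 : ℝ) • a ^ 2 + (1 / 2 : ℝ) • b ^ 2) ^ (p / 2) := by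
        congr 1
        simp only [smul_eq_mul]
        ring
    _ ≤ (1 / 2 : ℝ) • (a ^ 2) ^ (p / 2) + (1 / 2 : ℝ) • (b ^ 2) ^ (p / 2) :=
        (convexOn_rpow hp2).2 (sq_nonneg a) (sq_nonneg b) (by norm_num) (by norm_num)
          (by norm_num)
    _ = ((a ^ 2) ^ (p / 2) + (b ^ 2) ^ (p / 2)) / 2 := by
        simp only [smul_eq_mul]
        ring

section CentroidSeminorm

variable {n : ℕ} {B : Set (EuclideanSpace ℝ (Fin n))} {p : ℝ}

lemma memLp_inner_restrict (hB : IsCompact B) (p : ENNReal) (x : EuclideanSpace ℝ (Fin n)) :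
    MemLp (fun y => (inner ℝ y x : ℝ)) p (volume.restrict B) := by
  have : IsFiniteMeasure (volume.restrict B) := ⟨by simpa using hB.measure_lt_top⟩
  obtain ⟨R, hR⟩ := (Metric.isBounded_iff_subset_closedBall 0).1 hB.isBounded
  refine MemLp.of_bound (by fun_prop) (R * ‖x‖) ?_
  filter_upwards [ae_restrict_mem hB.measurableSet] with y hy
  refine (norm_inner_le_norm y x).trans ?_
  gcongr
  simpa using hR hy

/-- The support function of the `L_p`-centroid body of `B`: the seminorm sending `x` to the `L_p`
norm on `B` of the linear form `⟨·, x⟩`. -/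
noncomputable def centroidSeminorm (hB : IsCompact B) (hp : 1 ≤ p) :
    Seminorm ℝ (EuclideanSpace ℝ (Fin n)) :=
  Seminorm.of (fun x => lpNorm (fun y => (inner ℝ y x : ℝ)) (ENNReal.ofReal p) (volume.restrict B))
    (fun x y => by
      have := lpNorm_add_le (memLp_inner_restrict hB (ENNReal.ofReal p) x)
        (g := fun z => (inner ℝ z y : ℝ)) (by simpa using ENNReal.ofReal_le_ofReal hp)
      simpa only [inner_add_right, Pi.add_def] using this)
    (fun c x => by
      have := lpNorm_const_smul (p := ENNReal.ofReal p) c (fun y => (inner ℝ y x : ℝ))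
        (volume.restrict B)
      simpa only [inner_smul_right, Pi.smul_def, smul_eq_mul, coe_nnnorm] using this)

lemma centroidSeminorm_apply (hB : IsCompact B) (hp : 1 ≤ p) (x : EuclideanSpace ℝ (Fin n)) :
    centroidSeminorm hB hp x = (∫ y in B, |inner ℝ y x| ^ p) ^ (1 / p) := by
  have h := lpNorm_eq_integral_norm_rpow_toReal (p := ENNReal.ofReal p) (by simp; linarith)
    ENNReal.ofReal_ne_top (memLp_inner_restrict hB (ENNReal.ofReal p) x).aestronglyMeasurable
  rw [ENNReal.toReal_ofReal (by linarith), ← one_div] at h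
  exact h

lemma integrableOn_abs_inner_rpow (hB : IsCompact B) (hp : 1 ≤ p)
    (x : EuclideanSpace ℝ (Fin n)) : IntegrableOn (fun y => |(inner ℝ y x : ℝ)| ^ p) B := by
  have hp0 : 0 ≤ p := by linarith
  exact ContinuousOn.integrableOn_compact hB
    ((continuous_id.inner continuous_const).abs.rpow_const fun _ => Or.inr hp0).continuousOn

lemma centroidSeminorm_rpow (hB : IsCompact B) (hp : 1 ≤ p) (x : EuclideanSpace ℝ (Fin n)) :
    centroidSeminorm hB hp x ^ p = ∫ y in B, |inner ℝ y x| ^ p := by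
  rw [centroidSeminorm_apply, ← Real.rpow_mul (by positivity), one_div_mul_cancel (by linarith),
    Real.rpow_one]

/-- Clarkson's inequality for the seminorm of an `L_p`-centroid body. -/
lemma centroidSeminorm_clarkson (hB : IsCompact B) (hp : 2 ≤ p) (hp1 : 1 ≤ p)
    (x y : EuclideanSpace ℝ (Fin n)) :
    centroidSeminorm hB hp1 ((1 / 2 : ℝ) • (x + y)) ^ p
        + centroidSeminorm hB hp1 ((1 / 2 : ℝ) • (x - y)) ^ p
      ≤ (centroidSeminorm hB hp1 x ^ p + centroidSeminorm hB hp1 y ^ p) / 2 := by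
  simp only [centroidSeminorm_rpow]
  have hi := integrableOn_abs_inner_rpow hB hp1
  rw [← integral_add (hi _) (hi _), ← integral_add (hi _) (hi _), ← integral_div]
  refine integral_mono ((hi _).add (hi _)) (((hi _).add (hi _)).div_const 2) fun z => ?_
  have := abs_add_div_two_rpow_add_abs_sub_div_two_rpow_le hp (inner ℝ z x) (inner ℝ z y)
  simp only [inner_smul_right, inner_add_right, inner_sub_right]
  rw [one_div_mul_eq_div, one_div_mul_eq_div]
  exact this

lemma centroidSeminorm_le (hB : IsCompact B) (hvol : volume.real B = 1) (hp : 1 ≤ p)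
    {x : EuclideanSpace ℝ (Fin n)} {c : ℝ} (hc : 0 ≤ c) (hx : ∀ y ∈ B, |inner ℝ y x| ≤ c) :
    centroidSeminorm hB hp x ≤ c := by
  have hp0 : 0 < p := by linarith
  rw [← Real.rpow_le_rpow_iff (apply_nonneg _ _) hc hp0, centroidSeminorm_rpow]
  calc ∫ y in B, |inner ℝ y x| ^ p ≤ ∫ _ in B, c ^ p := by
        refine setIntegral_mono_on (integrableOn_abs_inner_rpow hB hp x)
          (integrableOn_const hB.measure_lt_top.ne) hB.measurableSet fun y hy => ?_
        exact Real.rpow_le_rpow (abs_nonneg _) (hx y hy) hp0.le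
    _ = c ^ p := by simp [hvol]

/-- If the linear form `⟨·, x⟩` attains its maximum over `B` at `y₀`, it stays above `1 - 2t` times
this maximum on the copy `(1 - t) y₀ + t B ⊆ B` of `B`, of volume `tⁿ`. With `t = 1 / p`
this bounds the `L_p` norm from below by the maximum, up to a factor close to one. -/
lemma le_mul_centroidSeminorm (hB : IsSymmetricConvexBody B) (hvol : volume.real B = 1)
    (hp : 2 < p) (hp1 : 1 ≤ p) {x y₀ : EuclideanSpace ℝ (Fin n)} (hy₀ : y₀ ∈ B)
    (hmax : ∀ y ∈ B, inner ℝ y x ≤ (inner ℝ y₀ x : ℝ)) :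
    inner ℝ y₀ x ≤ p ^ (n / p) / (1 - 2 / p) * centroidSeminorm hB.isCompact hp1 x := by
  have hp0 : 0 < p := by linarith
  have h2p : 2 / p < 1 := (div_lt_one hp0).2 hp
  have h2p' : 2 / p = 2 * p⁻¹ := div_eq_mul_inv 2 p
  have hpinv : 0 < p⁻¹ := by positivity
  set h : ℝ := inner ℝ y₀ x with hh
  have hh0 : 0 ≤ h := by simpa using hmax 0 hB.zero_mem
  set S : Set (EuclideanSpace ℝ (Fin n)) := ((1 - p⁻¹) • y₀) +ᵥ (p⁻¹ • B) with hS
  have hSB : S ⊆ B := by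
    rintro _ ⟨_, ⟨y, hy, rfl⟩, rfl⟩
    exact hB.convex hy₀ hy (by linarith) hpinv.le (by ring)
  have hScomp : IsCompact S := (hB.isCompact.smul p⁻¹).vadd _
  have hSvol : volume.real S = (p⁻¹) ^ n := by
    rw [hS, measureReal_def, measure_vadd, Measure.addHaar_smul, finrank_euclideanSpace_fin,
      ENNReal.toReal_mul, ← measureReal_def, hvol, ENNReal.toReal_ofReal (abs_nonneg _),
      abs_of_nonneg (by positivity), mul_one]
  have hlow : ((1 - 2 / p) * h) ^ p * (p⁻¹) ^ n ≤ centroidSeminorm hB.isCompact hp1 x ^ p := by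
    have hi := integrableOn_abs_inner_rpow hB.isCompact hp1 x
    rw [centroidSeminorm_rpow]
    calc ((1 - 2 / p) * h) ^ p * (p⁻¹) ^ n = ∫ _ in S, ((1 - 2 / p) * h) ^ p := by
          rw [setIntegral_const, hSvol, smul_eq_mul, mul_comm]
      _ ≤ ∫ y in S, |inner ℝ y x| ^ p := by
          refine setIntegral_mono_on (integrableOn_const hScomp.measure_lt_top.ne)
            (hi.mono_set hSB) hScomp.measurableSet ?_
          rintro _ ⟨_, ⟨y, hy, rfl⟩, rfl⟩
          refine Real.rpow_le_rpow (mul_nonneg (by linarith) hh0) ?_ hp0.le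
          refine le_trans ?_ (le_abs_self _)
          have hneg := hmax (-y) (hB.neg_mem y hy)
          rw [inner_neg_left] at hneg
          simp only [vadd_eq_add, inner_add_left, real_inner_smul_left]
          rw [← hh, h2p']
          nlinarith
      _ ≤ ∫ y in B, |inner ℝ y x| ^ p :=
          setIntegral_mono_set hi (Filter.Eventually.of_forall fun y => by positivity)
            hSB.eventuallyLE
  have hroot : (1 - 2 / p) * h * (p⁻¹) ^ (n / p) ≤ centroidSeminorm hB.isCompact hp1 x := by
    have h0 : 0 ≤ (1 - 2 / p) * h := mul_nonneg (by linarith) hh0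
    rw [← Real.rpow_le_rpow_iff (by positivity) (apply_nonneg _ _) hp0,
      Real.mul_rpow h0 (by positivity), ← Real.rpow_mul hpinv.le, div_mul_cancel₀ _ hp0.ne',
      Real.rpow_natCast]
    exact hlow
  rw [Real.inv_rpow hp0.le, ← div_eq_mul_inv, div_le_iff₀ (by positivity)] at hroot
  rw [div_mul_eq_mul_div, le_div_iff₀ (by linarith)]
  linarith

end CentroidSeminorm

/-- A seminorm satisfying Clarkson's inequality has a uniformly convex unit ball. The
`p`-th root is removed by `(1 - s) ^ (1 / p) ≤ 1 - s / p`. -/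
lemma Seminorm.midpoint_le_of_clarkson {E : Type*} [AddCommGroup E] [Module ℝ E]
    (q : Seminorm ℝ E) {p : ℝ} (hp : 1 ≤ p) {x y : E}
    (h : q ((1 / 2 : ℝ) • (x + y)) ^ p + q ((1 / 2 : ℝ) • (x - y)) ^ p ≤ (q x ^ p + q y ^ p) / 2)
    (hx : q x = 1) (hy : q y = 1) :
    q ((1 / 2 : ℝ) • (x + y)) ≤ 1 - 1 / (p * 2 ^ p) * q (x - y) ^ p := by
  have hp0 : 0 < p := by linarith
  set s := q ((1 / 2 : ℝ) • (x - y)) ^ p with hs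
  set m := q ((1 / 2 : ℝ) • (x + y)) with hm
  have hm0 : 0 ≤ m := apply_nonneg _ _
  have hs0 : 0 ≤ s := by positivity
  rw [hx, hy, Real.one_rpow] at h
  have hmp : 0 ≤ m ^ p := by positivity
  have hsv : s = q (x - y) ^ p / 2 ^ p := by
    rw [hs, map_smul_eq_mul, Real.norm_of_nonneg (by norm_num), one_div, inv_mul_eq_div,
      Real.div_rpow (apply_nonneg _ _) (by norm_num)]
  calc m = (m ^ p) ^ (1 / p) := by
        rw [← Real.rpow_mul hm0, mul_one_div_cancel hp0.ne', Real.rpow_one]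
    _ ≤ (1 + -s) ^ (1 / p) := by
        refine Real.rpow_le_rpow hmp (by linarith) (by positivity)
    _ ≤ 1 + 1 / p * -s :=
        rpow_one_add_le_one_add_mul_self (by linarith) (by positivity)
          ((div_le_one hp0).2 hp)
    _ = 1 - 1 / (p * 2 ^ p) * q (x - y) ^ p := by
        rw [hsv]
        field_simp
        ring

/-! ### Volume estimates -/

/-- With `u = log p / p`, the `n`-th power is `exp (n² u + O(1 / p)) = 1 + (n² + o(1)) u`, because
`1 / p = o(u)`; so it is at most `1 + 2 n² u` for large `p`. -/
lemma exists_forall_dilation_pow_le (n : ℕ) :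
    ∃ p₀ : ℝ, ∀ p : ℝ, p₀ ≤ p →
      2 < p ∧ (p ^ (n / p) / (1 - 2 / p)) ^ n ≤ 1 + 2 * (n : ℝ) ^ 2 * (Real.log p / p) := by
  have hu : Filter.Tendsto (fun p : ℝ => (n : ℝ) ^ 2 * (Real.log p / p)) Filter.atTop
      (nhds 0) := by
    simpa using (Real.isLittleO_log_id_atTop.tendsto_div_nhds_zero).const_mul ((n : ℝ) ^ 2)
  -- `log p ≥ 16` makes the error term at most `n² u / 4`, and `n² u ≤ 2 / 5` makes the
  -- exponent `w` at most `1 / 2`, so that `exp w ≤ 1 + 3 w / 2`.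
  obtain ⟨p₀, h⟩ := Filter.eventually_atTop.1
    (((Filter.eventually_ge_atTop (4 : ℝ)).and
      (Real.tendsto_log_atTop.eventually_ge_atTop 16)).and
      (hu.eventually_le_const (show (0 : ℝ) < 2 / 5 by norm_num)))
  refine ⟨p₀, fun p hp => ?_⟩
  obtain ⟨⟨hp4, hlog⟩, hsmall⟩ := h p hp
  refine ⟨by linarith, ?_⟩
  have hp0 : 0 < p := by linarith
  set u := Real.log p / p with hu'
  set s := 2 / p with hs
  have hs0 : 0 < s := by positivity
  have hs2 : s ≤ 1 / 2 := by
    rw [hs, div_le_div_iff₀ hp0 (by norm_num)]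
    linarith
  have hsu : 8 * s ≤ u := by
    rw [hs, hu', ← mul_div_assoc]
    gcongr
    linarith
  -- `1 / (1 - s) ≤ exp (2 s)` for `0 ≤ s ≤ 1 / 2`.
  have hfac : p ^ (n / p) / (1 - s) ≤ Real.exp (n * u + 2 * s) := by
    rw [div_le_iff₀ (by linarith), Real.exp_add, Real.rpow_def_of_pos hp0,
      show Real.log p * (n / p) = n * u by rw [hu']; ring, mul_assoc]
    refine le_mul_of_one_le_right (Real.exp_pos _).le ?_
    have := Real.add_one_le_exp (2 * s)
    nlinarith
  have hnn : (n : ℝ) ≤ (n : ℝ) ^ 2 := by exact_mod_cast Nat.le_self_pow two_ne_zero n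
  set w := (n : ℝ) * (n * u + 2 * s) with hw
  have hw0 : 0 ≤ w := by
    have : 0 ≤ u := by linarith
    positivity
  have hwle : w ≤ 5 / 4 * ((n : ℝ) ^ 2 * u) := by
    have h1 : (n : ℝ) * s ≤ (n : ℝ) ^ 2 * (u / 8) := by
      gcongr
      linarith
    rw [hw]
    linarith
  have hexp : Real.exp w ≤ 1 + w + w ^ 2 := by
    have := (abs_le.1 (Real.abs_exp_sub_one_sub_id_le (x := w)
      (abs_le.2 ⟨by linarith, by linarith⟩))).2
    linarith
  calc (p ^ (n / p) / (1 - s)) ^ n ≤ Real.exp (n * u + 2 * s) ^ n := by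
        refine pow_le_pow_left₀ (div_nonneg (by positivity) (by linarith)) hfac n
    _ = Real.exp w := by rw [← Real.exp_nat_mul]
    _ ≤ 1 + w + w ^ 2 := hexp
    _ ≤ 1 + 3 / 2 * w := by nlinarith
    _ ≤ 1 + 2 * (n : ℝ) ^ 2 * u := by linarith

lemma symmDiffDist_le_of_subset_smul {n : ℕ} {P K : Set (EuclideanSpace ℝ (Fin n))}
    (hP : IsCompact P) (hPK : P ⊆ K) {r ε : ℝ} (hr : 0 ≤ r) (hKP : K ⊆ r • P)
    (hrε : r ^ n ≤ 1 + ε) : symmDiffDist P K ≤ ε * volume.real P := by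
  have hfin : volume (r • P) ≠ ⊤ := (hP.smul r).measure_lt_top.ne
  have hvol : volume.real (r • P) = r ^ n * volume.real P := by
    rw [measureReal_def, Measure.addHaar_smul, finrank_euclideanSpace_fin, ENNReal.toReal_mul,
      ENNReal.toReal_ofReal (abs_nonneg _), abs_of_nonneg (by positivity), measureReal_def]
  calc symmDiffDist P K ≤ volume.real (r • P \ P) := by
        rw [symmDiffDist, Set.sdiff_eq_empty.2 hPK, Set.empty_union]
        exact measureReal_mono (Set.sdiff_subset_sdiff_left hKP)
          (measure_ne_top_of_subset Set.sdiff_subset hfin)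
    _ = r ^ n * volume.real P - volume.real P := by
        rw [measureReal_sdiff (hPK.trans hKP) hP.measurableSet hfin, hvol]
    _ ≤ ε * volume.real P := by
        have := mul_le_mul_of_nonneg_right hrε (measureReal_nonneg (μ := volume) (s := P))
        linarith

/-- The dilate of volume one. In dimension zero volume is the Dirac mass. -/
lemma volume_real_rpow_smul {n : ℕ} {Q : Set (EuclideanSpace ℝ (Fin n))}
    (hQ : IsSymmetricConvexBody Q) :
    volume.real ((volume.real Q ^ (-(1 / (n : ℝ)))) • Q) = 1 := by
  have hv := hQ.volume_real_pos
  rcases Nat.eq_zero_or_pos n with rfl | hn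
  · have hdirac : volume.real Q = 1 := by
      rw [measureReal_def, volume_euclideanSpace_eq_dirac,
        Measure.dirac_apply_of_mem hQ.zero_mem, ENNReal.toReal_one]
    rw [hdirac, Real.one_rpow, one_smul, hdirac]
  · rw [measureReal_def, Measure.addHaar_smul, finrank_euclideanSpace_fin, ENNReal.toReal_mul,
      ENNReal.toReal_ofReal (abs_nonneg _), abs_of_nonneg (by positivity), ← measureReal_def,
      ← Real.rpow_natCast, ← Real.rpow_mul hv.le, neg_mul, one_div_mul_cancel (by positivity),
      Real.rpow_neg_one, inv_mul_cancel₀ hv.ne']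

/-! ### The approximating bodies -/

theorem theorem1p2 (n : ℕ) (P : Set (EuclideanSpace ℝ (Fin n))) (hP : IsSymmetricPolytope P) :
    ∃ p₀ : ℝ, ∀ p : ℝ, p₀ ≤ p →
      ∃ K Z : Set (EuclideanSpace ℝ (Fin n)),
        IsUniformlyConvexBody p (1 / (p * (2 : ℝ) ^ p)) K ∧
        P ⊆ K ∧
        symmDiffDist P K ≤ 2 * (n : ℝ) ^ 2 * volume.real P * (Real.log p / p) ∧
        IsLpCentroidBody p
          ((volume.real (polarBody P) ^ (-(1 / (n : ℝ)))) • polarBody P) Z ∧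
        K = (volume.real (polarBody P) ^ (-(1 / (n : ℝ)))) • polarBody Z := by
  obtain ⟨p₀, hp₀⟩ := exists_forall_dilation_pow_le n
  refine ⟨p₀, fun p hp => ?_⟩
  obtain ⟨hp2, hdil⟩ := hp₀ p hp
  have hp1 : 1 ≤ p := by linarith
  have hPb := hP.isSymmetricConvexBody
  have hQb := hPb.polarBody
  have hB1 := volume_real_rpow_smul hQb
  set a := volume.real (polarBody P) ^ (-(1 / (n : ℝ))) with ha
  have ha0 : 0 < a := Real.rpow_pos_of_pos hQb.volume_real_pos _
  have hBb := hQb.smul ha0.ne'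
  set B := a • polarBody P with hB
  set q := centroidSeminorm hBb.isCompact hp1 with hq
  set r := p ^ (n / p) / (1 - 2 / p) with hr
  have hr0 : 0 < r := by
    have : 2 / p < 1 := (div_lt_one (by linarith)).2 hp2
    exact div_pos (by positivity) (by linarith)
  -- The support function of `B` is at most `r q`.
  have hsupp : ∀ x, ∀ y ∈ B, inner ℝ y x ≤ r * q x := by
    intro x y hy
    obtain ⟨y₀, hy₀, hmax⟩ := hBb.isCompact.exists_isMaxOn ⟨0, hBb.zero_mem⟩
      (f := fun y => (inner ℝ y x : ℝ)) (by fun_prop)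
    exact (hmax hy).trans (le_mul_centroidSeminorm hBb hB1 hp2 hp1 hy₀ fun z hz => hmax hz)
  obtain ⟨C, hup⟩ : ∃ C : ℝ, ∀ x, q x ≤ C * ‖x‖ := by
    obtain ⟨R, hR⟩ := (Metric.isBounded_iff_subset_closedBall 0).1 hBb.isCompact.isBounded
    refine ⟨|R|, fun x =>
      centroidSeminorm_le hBb.isCompact hB1 hp1 (by positivity) fun y hy => ?_⟩
    refine (abs_real_inner_le_norm y x).trans ?_
    gcongr
    exact (mem_closedBall_zero_iff.1 (hR hy)).trans (le_abs_self R)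
  obtain ⟨c, hc, hlow⟩ : ∃ c : ℝ, 0 < c ∧ ∀ x, c * ‖x‖ ≤ q x := by
    obtain ⟨δ, hδ, hball⟩ := Metric.nhds_basis_closedBall.mem_iff.1
      (mem_interior_iff_mem_nhds.1 hBb.zero_mem_interior)
    refine ⟨δ / r, by positivity, fun x => ?_⟩
    rcases eq_or_ne x 0 with rfl | hx
    · simp
    have hx0 : 0 < ‖x‖ := norm_pos_iff.2 hx
    have h1 := hsupp x ((δ / ‖x‖) • x) (hball (by
      rw [mem_closedBall_zero_iff, norm_smul, Real.norm_of_nonneg (by positivity),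
        div_mul_cancel₀ _ hx0.ne']))
    rw [real_inner_smul_left, real_inner_self_eq_norm_sq] at h1
    rw [div_mul_eq_mul_div, div_le_iff₀ hr0, mul_comm (q x)]
    calc δ * ‖x‖ = δ / ‖x‖ * ‖x‖ ^ 2 := by field_simp
      _ ≤ r * q x := h1
  have hZb := q.isSymmetricConvexBody_dualBody hc hlow hup
  have hKb := hZb.polarBody.smul ha0.ne'
  have hgauge : ∀ x, gauge (a • polarBody q.dualBody) x = q (a⁻¹ • x) := by
    intro x
    rw [q.polarBody_dualBody, gauge_smul_left_of_nonneg ha0.le, q.gauge_closedBall,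
      map_smul_eq_mul, Real.norm_of_nonneg (by positivity)]
    rfl
  have hmemK : ∀ x, x ∈ a • polarBody q.dualBody ↔ q x ≤ a := by
    intro x
    rw [Set.mem_smul_set_iff_inv_smul_mem₀ ha0.ne', q.polarBody_dualBody, q.mem_closedBall_zero,
      map_smul_eq_mul, Real.norm_of_nonneg (by positivity), inv_mul_le_one₀ ha0]
  have hPK : P ⊆ a • polarBody q.dualBody := by
    intro x hx
    refine (hmemK x).2 (centroidSeminorm_le hBb.isCompact hB1 hp1 ha0.le ?_)
    have hle : ∀ y ∈ B, inner ℝ y x ≤ a := by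
      rintro _ ⟨y, hy, rfl⟩
      simp only [real_inner_smul_left]
      rw [real_inner_comm]
      exact mul_le_of_le_one_right ha0.le (hy x hx)
    intro y hy
    refine abs_le.2 ⟨?_, hle y hy⟩
    have := hle (-y) (hBb.neg_mem y hy)
    rw [inner_neg_left] at this
    linarith
  refine ⟨a • polarBody q.dualBody, q.dualBody, ⟨hKb, hp2.le, by positivity, ?_⟩, hPK, ?_,
    ⟨hZb.convex, hZb.isCompact, hZb.interior_nonempty, fun θ _ => ?_⟩, rfl⟩
  · have hfr : ∀ x ∈ frontier (a • polarBody q.dualBody), q (a⁻¹ • x) = 1 := by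
      intro x hx
      rw [← hgauge]
      exact (gauge_eq_one_iff_mem_frontier hKb.convex
        (mem_interior_iff_mem_nhds.1 hKb.zero_mem_interior)).2 hx
    intro x hx y hy
    have h := q.midpoint_le_of_clarkson hp1
      (centroidSeminorm_clarkson hBb.isCompact hp2.le hp1 (a⁻¹ • x) (a⁻¹ • y))
      (hfr x hx) (hfr y hy)
    rwa [hgauge, hgauge, smul_comm, smul_add, smul_sub]
  · rw [mul_right_comm]
    refine symmDiffDist_le_of_subset_smul hPb.isCompact hPK hr0.le ?_ hdil
    intro x hx
    rw [Set.mem_smul_set_iff_inv_smul_mem₀ hr0.ne']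
    refine mem_of_forall_polarBody hPb.convex hPb.isCompact.isClosed hPb.zero_mem fun y hy => ?_
    have h1 := hsupp x (a • y) (Set.smul_mem_smul_set hy)
    rw [real_inner_smul_left, real_inner_comm] at h1
    have h2 : a * inner ℝ x y ≤ a * r := by
      have := mul_le_mul_of_nonneg_left ((hmemK x).1 hx) hr0.le
      linarith
    rw [real_inner_smul_left, inv_mul_le_one₀ hr0]
    exact le_of_mul_le_mul_left h2 ha0
  · rw [q.supportFunction_dualBody, hq, centroidSeminorm_apply]
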